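/- Let $X\subset\mathbb{R}^d$ be closed and convex, let $\varphi:\mathbb{R}^d\to\mathbb{R}$ be convex, let $P$ be a probability measure on a measurable space $\mathcal{S}$, and let $f(\cdot;s):\mathbb{R}^d\to\mathbb{R}$, $s\in\mathcal{S}$, be functions such that $f(y;\cdot)$ is measurable for every $y\in\mathbb{R}^d$ and $P$-integrable for every $y\in X$. Put $f(y)=\mathbb{E}_P[f(y;S)]$. Assume that for every $x\in X$ there is $\varepsilon>0$ such that 1. (local Lipschitz continuity) there is $M:\mathcal{S}\to\mathbb{R}$ with $\mathbb{E}_P[M(S)^2]<\infty$ such that, for $P$-almost every $s$, $|f(y;s)-f(z;s)|\le M(s)\|y-z\|$ whenever $\|y-x\|\le\varepsilon$ and $\|z-x\|\le\varepsilon$; 2. (weak convexity) there is a $P$-integrable $\lambda:\mathcal{S}\to[0,\infty)$ such that, for $P$-almost every $s$, $y\mapsto f(y;s)+\frac{\lambda(s)}{2}\|y-x\|^2$ is convex on $\{y:\|y-x\|\le\varepsilon\}$. Write $\partial f(x)$ and $\partial f(x;s)$ for the Fréchet subdifferentials of $f$ and of $f(\cdot;s)$ at $x$ (the set of $g$ with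 $f(y)\ge f(x)+\langle g,y-x\rangle+o(\|y-x\|)$ as $y\to x$), $\partial\varphi$ for the convex subdifferential, and $\mathcal{N}_X(x)=\{w:\langle w,y-x\rangle\le0\ \text{for all } y\in X\}$ for $x\in X$, $\mathcal{N}_X(x)=\emptyset$ for $x\notin X$. Let $$G(x)=\int_{\mathcal{S}}\partial f(x;s)\,dP(s)+\partial\varphi(x),$$ where the integral of a set-valued map $A$ is the set of all $\int g\,dP$ with $g$ integrable and $g(s)\in A(s)$ for $P$-almost every $s$. Let $\mathsf{g}^\star(x)$ denote the element of least norm of $\partial f(x)+\partial\varphi(x)+\mathcal{N}_X(x)$. Let $x:[0,\infty)\to\mathbb{R}^d$ be a trajectory of $\dot x\in-G(x)-\mathcal{N}_X(x)$, that is, $x$ is absolutely continuous on every $[0,T]$ and $\dot x(t)$ exists and lies in $-G(x(t))-\mathcal{N}_X(x(t))$ for almost every $t\ge0$. Let $x_\infty$ be a cluster point of $x(\cdot)$: there are increasing $t_n\to\infty$ with $x(t_n)\to x_\infty$. Then $x_\infty$ is stationary: $\mathsf{g}^\star(x_\infty)$ exists and equals $0$, and $0\in G(x_\infty)+\mathcal{N}_X(x_\infty)$.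 -/

import Mathlib

open Set Filter Topology MeasureTheory
open scoped Pointwise

noncomputable section

namespace WeaklyConvexFlow

/-- `ℝ^d` with its Euclidean norm and inner product. -/
abbrev E (d : ℕ) : Type := EuclideanSpace ℝ (Fin d)

/-- The Fréchet subdifferential: all `g` with
`f y ≥ f x + ⟪g, y - x⟫ + o(‖y - x‖)` as `y → x`. -/
def frechetSubdiff {d : ℕ} (f : E d → ℝ) (x : E d) : Set (E d) :=
  {g | ∀ ε : ℝ, 0 < ε → ∀ᶠ y in 𝓝 x,
    f x + inner ℝ g (y - x) - ε * ‖y - x‖ ≤ f y}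

/-- The subdifferential of convex analysis: all `v` with `φ y ≥ φ x + ⟪v, y - x⟫` for all `y`. -/
def convexSubdiff {d : ℕ} (φ : E d → ℝ) (x : E d) : Set (E d) :=
  {v | ∀ y : E d, φ x + inner ℝ v (y - x) ≤ φ y}

/-- The normal cone of a convex set `X` at `x`; it is empty when `x ∉ X`. -/
def normalCone {d : ℕ} (X : Set (E d)) (x : E d) : Set (E d) :=
  {w | x ∈ X ∧ ∀ y ∈ X, inner ℝ w (y - x) ≤ 0}

/-- The (Aumann) integral `∫ A dP` of a set-valued map: all integrals of integrable selections. -/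
def setIntegral {d : ℕ} {S : Type*} [MeasurableSpace S] (P : Measure S) (A : S → Set (E d)) :
    Set (E d) :=
  {v | ∃ g : S → E d, Integrable g P ∧ (∀ᵐ s ∂P, g s ∈ A s) ∧ v = ∫ s, g s ∂P}

/-- The expected function `f(x) = 𝔼_P[f(x; S)]`. -/
def expected {d : ℕ} {S : Type*} [MeasurableSpace S] (P : Measure S) (f : E d → S → ℝ) :
    E d → ℝ :=
  fun x => ∫ s, f x s ∂P

/-- The set-valued map `G(x) = ∫ ∂f(x; s) dP(s) + ∂φ(x)`. -/
def subgradientMap {d : ℕ} {S : Type*} [MeasurableSpace S] (P : Measure S)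
    (f : E d → S → ℝ) (φ : E d → ℝ) (x : E d) : Set (E d) :=
  setIntegral P (fun s => frechetSubdiff (fun y => f y s) x) + convexSubdiff φ x

/-- `g = g⋆(x)`: `g` is an element of least norm of `∂f(x) + ∂φ(x) + N_X(x)`, where
`f` is the expected function. -/
def IsMinimalSubgradient {d : ℕ} {S : Type*} [MeasurableSpace S] (P : Measure S)
    (f : E d → S → ℝ) (φ : E d → ℝ) (X : Set (E d)) (x g : E d) : Prop :=
  g ∈ frechetSubdiff (expected P f) x + convexSubdiff φ x + normalCone X x ∧
    ∀ h ∈ frechetSubdiff (expected P f) x + convexSubdiff φ x + normalCone X x, ‖g‖ ≤ ‖h‖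

/-- Near every point of `X` the random function `f(·; s)` is Lipschitz, with a
square-integrable Lipschitz constant. -/
def LocallyLipschitzOn {d : ℕ} {S : Type*} [MeasurableSpace S] (P : Measure S)
    (f : E d → S → ℝ) (X : Set (E d)) : Prop :=
  ∀ x ∈ X, ∃ ε : ℝ, 0 < ε ∧ ∃ M : S → ℝ, MemLp M 2 P ∧
    ∀ᵐ s ∂P, ∀ y ∈ Metric.closedBall x ε, ∀ z ∈ Metric.closedBall x ε,
      |f y s - f z s| ≤ M s * ‖y - z‖

/-- Near every point of `X` the random function `f(·; s)` is weakly convex, with an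
integrable modulus. -/
def LocallyWeaklyConvexOn {d : ℕ} {S : Type*} [MeasurableSpace S] (P : Measure S)
    (f : E d → S → ℝ) (X : Set (E d)) : Prop :=
  ∀ x ∈ X, ∃ ε : ℝ, 0 < ε ∧ ∃ lam : S → ℝ, Integrable lam P ∧ (∀ s, 0 ≤ lam s) ∧
    ∀ᵐ s ∂P, ConvexOn ℝ (Metric.closedBall x ε) (fun y => f y s + lam s / 2 * ‖y - x‖ ^ 2)

/-- `x : [0, ∞) → ℝ^d` is a solution of `ẋ ∈ H(x)`: it is absolutely continuous on bounded
intervals and satisfies the inclusion at almost every time. Values at negative times are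
irrelevant. -/
def IsTrajectory {d : ℕ} (H : E d → Set (E d)) (x : ℝ → E d) : Prop :=
  (∀ T : ℝ, 0 ≤ T → AbsolutelyContinuousOnInterval x 0 T) ∧
    ∀ᵐ t ∂(volume.restrict (Ici (0 : ℝ))), ∃ v : E d, HasDerivAt x v t ∧ v ∈ H (x t)

/-- `p` is a cluster point of the trajectory: `x(t_n) → p` for some increasing `t_n → ∞`. -/
def IsTrajectoryClusterPt {d : ℕ} (x : ℝ → E d) (p : E d) : Prop :=
  ∃ t : ℕ → ℝ, (∀ n, 0 ≤ t n) ∧ StrictMono t ∧ Tendsto t atTop atTop ∧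
    Tendsto (fun n => x (t n)) atTop (𝓝 p)

end WeaklyConvexFlow

end

/-! Let `F` be the expected function plus `φ`; it is locally Lipschitz on `X`. Along the trajectory
`-ẋ(t)` is a Fréchet subgradient of `F` restricted to `X`, and the chain rule along a curve in `X`
holds with any such subgradient (`deriv_comp_eq_inner`). Hence `(F ∘ x)' = -‖ẋ‖²` almost everywhere.

Suppose all elements of `G + N_X` near the cluster point had norm at least `c > 0`. Then the
distance travelled there costs at least `c` times as much descent of `F`. Since `F (x t)` decreases
to `F p`, a trajectory that comes close enough to `p` late enough is trapped near `p`, where `F`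
falls at rate at least `c²` forever; this is absurd (`not_clusterPt_of_speed_bound`). So there are
`y k → p` and `u k → 0` with `u k` in `G + N_X` at `y k`.

The closed graph of `G + N_X` (`mem_subgradientMap_add_normalCone_of_tendsto`) then gives
stationarity. Its delicate part is the set-valued integral: selections dominated by a
square-integrable function have convex combinations of tails that converge in `L²` and, along a
subsequence, almost everywhere. Weak convexity makes their pointwise limit a selection of the
subdifferentials at the limit point. Finally, the integral of the subdifferentials lies in the
subdifferential of the expectation. -/

/-! ### Absolutely continuous curves -/

/-- The composition of a Lipschitz map with an absolutely continuous curve is absolutely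
continuous. -/
theorem LipschitzOnWith.comp_absolutelyContinuousOnInterval {Y Z : Type*} [PseudoMetricSpace Y]
    [PseudoMetricSpace Z] {K : NNReal} {s : Set Y} {F : Y → Z} {x : ℝ → Y} {a b : ℝ}
    (hF : LipschitzOnWith K F s) (hx : AbsolutelyContinuousOnInterval x a b)
    (hs : MapsTo x (uIcc a b) s) : AbsolutelyContinuousOnInterval (fun t => F (x t)) a b := by
  rw [AbsolutelyContinuousOnInterval] at hx ⊢
  have h := hx.const_mul (K : ℝ)
  rw [mul_zero] at h
  refine squeeze_zero' (Eventually.of_forall fun I => Finset.sum_nonneg fun i _ => dist_nonneg)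
    ?_ h
  filter_upwards [mem_inf_of_right (mem_principal_self _)] with I hI
  rw [Finset.mul_sum]
  exact Finset.sum_le_sum fun i hi =>
    hF.dist_le_mul _ (hs (hI.1 i hi).1) _ (hs (hI.1 i hi).2)

/-- An absolutely continuous function with nonpositive derivative almost everywhere does not
increase. -/
theorem AbsolutelyContinuousOnInterval.le_of_deriv_nonpos {f : ℝ → ℝ} {a b : ℝ} (hab : a ≤ b)
    (hf : AbsolutelyContinuousOnInterval f a b)
    (h : ∀ᵐ t, t ∈ Icc a b → deriv f t ≤ 0) : f b ≤ f a := by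
  have h1 := hf.integral_deriv_eq_sub
  have h2 : ∫ t in a..b, deriv f t ≤ 0 := by
    rw [intervalIntegral.integral_of_le hab]
    refine setIntegral_nonpos_of_ae_restrict ?_
    rw [EventuallyLE, ae_restrict_iff' measurableSet_Ioc]
    filter_upwards [h] with t ht hm
    exact ht (Ioc_subset_Icc_self hm)
  linarith

/-! ### Descent along subgradient curves -/

namespace WeaklyConvexFlow

section Descent

variable {V : Type*} [NormedAddCommGroup V] [InnerProductSpace ℝ V]

/-- The Fréchet subdifferential at `x` of the restriction of `F` to `X`. -/
def subdiffWithin (F : V → ℝ) (X : Set V) (x : V) : Set V :=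
  {g | ∀ ε : ℝ, 0 < ε → ∀ᶠ y in 𝓝[X] x, F x + inner ℝ g (y - x) - ε * ‖y - x‖ ≤ F y}

/-- The chain rule along a curve in `X`, for any subgradient. -/
theorem deriv_comp_eq_inner {F : V → ℝ} {X : Set V} {x : ℝ → V} {t : ℝ} {v g : V}
    (hx : HasDerivAt x v t) (hX : ∀ᶠ s in 𝓝 t, x s ∈ X) (hg : g ∈ subdiffWithin F X (x t))
    (hd : DifferentiableAt ℝ (fun s => F (x s)) t) :
    deriv (fun s => F (x s)) t = inner ℝ g v := by
  set m : ℝ := deriv (fun s => F (x s)) t - inner ℝ g v with hm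
  have key : ∀ ε : ℝ, 0 < ε → |m| ≤ ε * (‖v‖ + 2) := by
    intro ε hε
    have htend : Tendsto x (𝓝 t) (𝓝[X] (x t)) :=
      tendsto_nhdsWithin_iff.2 ⟨hx.continuousAt, hX⟩
    have h1 := htend.eventually (hg ε hε)
    have h2 := (hasDerivAt_iff_isLittleO.1 hx).bound one_pos
    have hh : HasDerivAt (fun s => F (x s) - inner ℝ g (x s)) m t :=
      hd.hasDerivAt.sub (((innerSL ℝ g).hasFDerivAt.comp_hasDerivAt t hx))
    have h3 := (hasDerivAt_iff_isLittleO.1 hh).bound hε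
    -- Up to `ε`, the function `F ∘ x - ⟪g, x⟫` has a local minimum at `t`, so its derivative `m`
    -- must vanish. Of the constant, `‖v‖ + 1` bounds the speed of `x` near `t` and `1` pays for the
    -- remainder of the derivative.
    have h4 : ∀ᶠ s in 𝓝 t, -(ε * (‖v‖ + 2)) * |s - t| ≤ m * (s - t) := by
      filter_upwards [h1, h2, h3] with s a1 a2 a3
      have b1 : ‖x s - x t‖ ≤ (‖v‖ + 1) * |s - t| := by
        have := norm_add_le (x s - x t - (s - t) • v) ((s - t) • v)
        rw [sub_add_cancel, norm_smul] at this
        simp only [Real.norm_eq_abs, one_mul] at a2 this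
        linarith
      have b2 := (abs_le.1 a3).2
      simp only [smul_eq_mul, Real.norm_eq_abs] at b2
      rw [inner_sub_right] at a1
      have := mul_le_mul_of_nonneg_left b1 hε.le
      linarith
    obtain ⟨δ, hδ, hball⟩ := Metric.eventually_nhds_iff.1 h4
    have e1 := @hball (t + δ / 2) (by simp [abs_of_pos hδ, hδ])
    have e2 := @hball (t - δ / 2) (by simp [abs_of_pos hδ, hδ])
    have hδ2 : 0 < δ / 2 := by linarith
    rw [add_sub_cancel_left, abs_of_pos hδ2] at e1
    rw [sub_sub_cancel_left, abs_neg, abs_of_pos hδ2] at e2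
    rw [abs_le]
    constructor
    · exact le_of_mul_le_mul_right e1 hδ2
    · refine le_of_mul_le_mul_right ?_ hδ2
      linarith
  have hm0 : |m| ≤ 0 := by
    refine le_of_forall_pos_le_add fun η hη => ?_
    have hv : 0 < ‖v‖ + 2 := by positivity
    have := key (η / (‖v‖ + 2)) (by positivity)
    rwa [div_mul_cancel₀ _ hv.ne', ← zero_add η] at this
  have : m = 0 := abs_eq_zero.1 (le_antisymm hm0 (abs_nonneg _))
  linarith

/-- A curve that is absolutely continuous on bounded intervals, stays in `X`, and moves along
negative subgradients of a locally Lipschitz function at a speed that is bounded below near `p`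
cannot have `p` as a cluster point. -/
theorem not_clusterPt_of_speed_bound {F : V → ℝ} {X : Set V} (hF : _root_.LocallyLipschitzOn X F)
    {x : ℝ → V} (hac : ∀ T : ℝ, 0 ≤ T → AbsolutelyContinuousOnInterval x 0 T)
    (hxX : ∀ t, 0 ≤ t → x t ∈ X) {p : V} (hp : p ∈ X) {r c : ℝ} (hr : 0 < r) (hc : 0 < c)
    (hx : ∀ᵐ t : ℝ, 0 ≤ t → ∃ v, HasDerivAt x v t ∧ -v ∈ subdiffWithin F X (x t) ∧
      (x t ∈ Metric.ball p r → c ≤ ‖v‖))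
    {τ : ℕ → ℝ} (hτ0 : ∀ n, 0 ≤ τ n) (hτ : Tendsto τ atTop atTop)
    (hτp : Tendsto (fun n => x (τ n)) atTop (𝓝 p)) : False := by
  have hacI : ∀ a b, 0 ≤ a → a ≤ b → AbsolutelyContinuousOnInterval x a b := fun a b ha hab =>
    (hac b (ha.trans hab)).mono (by
      rw [uIcc_of_le hab, uIcc_of_le (ha.trans hab)]
      exact Icc_subset_Icc_left ha)
  have hcont : ∀ a b, 0 ≤ a → a ≤ b → ContinuousOn x (Icc a b) := fun a b ha hab => by
    have := (hacI a b ha hab).continuousOn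
    rwa [uIcc_of_le hab] at this
  have hacF : ∀ a b, 0 ≤ a → a ≤ b → AbsolutelyContinuousOnInterval (fun t => F (x t)) a b := by
    intro a b ha hab
    have hsub : x '' Icc a b ⊆ X := by
      rintro _ ⟨t, ht, rfl⟩
      exact hxX t (ha.trans ht.1)
    obtain ⟨K, hK⟩ := (hF.mono hsub).exists_lipschitzOnWith_of_compact
      (isCompact_Icc.image_of_continuousOn (hcont a b ha hab))
    refine hK.comp_absolutelyContinuousOnInterval (hacI a b ha hab) ?_
    rw [uIcc_of_le hab]
    exact mapsTo_image _ _
  have hderiv : ∀ a b, 0 ≤ a → a ≤ b → ∀ᵐ t : ℝ, t ∈ Icc a b → ∃ v, HasDerivAt x v t ∧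
      HasDerivAt (fun t => F (x t)) (-‖v‖ ^ 2) t ∧ (x t ∈ Metric.ball p r → c ≤ ‖v‖) := by
    intro a b ha hab
    -- The chain rule needs the curve to be in `X` on both sides of `t`, which is not known at `t =
    -- 0`.
    have hne : ∀ᵐ t : ℝ, t ≠ 0 := by simp [ae_iff]
    filter_upwards [hx, (hacF a b ha hab).ae_differentiableAt, hne] with t h1 h2 h3 ht
    have ht0 : 0 ≤ t := ha.trans ht.1
    obtain ⟨v, hv, hg, hcv⟩ := h1 ht0
    have hd := h2 (by rwa [uIcc_of_le hab])
    have hX : ∀ᶠ s in 𝓝 t, x s ∈ X :=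
      (eventually_gt_nhds (lt_of_le_of_ne ht0 h3.symm)).mono fun s hs => hxX s hs.le
    refine ⟨v, hv, ?_, hcv⟩
    have := hd.hasDerivAt
    rwa [deriv_comp_eq_inner hv hX hg hd, inner_neg_left, real_inner_self_eq_norm_sq] at this
  have hanti : ∀ a b, 0 ≤ a → a ≤ b → F (x b) ≤ F (x a) := by
    intro a b ha hab
    refine (hacF a b ha hab).le_of_deriv_nonpos hab ?_
    filter_upwards [hderiv a b ha hab] with t ht htm
    obtain ⟨v, -, h, -⟩ := ht htm
    rw [h.deriv]
    nlinarith [norm_nonneg v]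
  have hlim : Tendsto (fun n => F (x (τ n))) atTop (𝓝 (F p)) :=
    (hF.continuousOn p hp).tendsto.comp
      (tendsto_nhdsWithin_iff.2 ⟨hτp, Eventually.of_forall fun n => hxX _ (hτ0 n)⟩)
  have hlow : ∀ t, 0 ≤ t → F p ≤ F (x t) := by
    intro t ht
    refine le_of_tendsto hlim ?_
    filter_upwards [hτ.eventually_ge_atTop t] with n hn using hanti t _ ht hn
  have hlength : ∀ a b, 0 ≤ a → a ≤ b → (∀ t ∈ Ico a b, x t ∈ Metric.ball p r) →
      c * ‖x b - x a‖ ≤ F (x a) - F (x b) := by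
    intro a b ha hab hball
    -- Projecting on the direction of displacement replaces arc length: `F ∘ x + c ⟪e, x⟫` has
    -- derivative at most `‖v‖ (c - ‖v‖) ≤ 0`. If `x a = x b`, then `e = 0`.
    set e : V := (‖x b - x a‖)⁻¹ • (x b - x a) with he
    have hen : ‖e‖ ≤ 1 := by
      rw [he, norm_smul, norm_inv, norm_norm]
      exact inv_mul_le_one
    have hee : inner ℝ e (x b - x a) = ‖x b - x a‖ := by
      rw [he, real_inner_smul_left, real_inner_self_eq_norm_sq]
      rcases eq_or_ne ‖x b - x a‖ 0 with h | h
      · simp [h]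
      · field_simp
    have hace : AbsolutelyContinuousOnInterval (fun t => inner ℝ e (x t)) a b :=
      ((innerSL ℝ e).lipschitz.lipschitzOnWith (s := univ)).comp_absolutelyContinuousOnInterval
        (hacI a b ha hab) (mapsTo_univ _ _)
    have := ((hacF a b ha hab).fun_add (hace.const_mul c)).le_of_deriv_nonpos hab (by
      have hne : ∀ᵐ t : ℝ, t ≠ b := by simp [ae_iff]
      filter_upwards [hderiv a b ha hab, hne] with t ht htb htm
      obtain ⟨v, hv, h, hcv⟩ := ht htm
      have hce := hcv (hball t ⟨htm.1, lt_of_le_of_ne htm.2 htb⟩)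
      have hd : HasDerivAt (fun t => F (x t) + c * inner ℝ e (x t))
          (-‖v‖ ^ 2 + c * inner ℝ e v) t :=
        h.add (((innerSL ℝ e).hasFDerivAt.comp_hasDerivAt t hv).const_mul c)
      rw [hd.deriv]
      have h5 : inner ℝ e v ≤ ‖v‖ :=
        (real_inner_le_norm e v).trans (mul_le_of_le_one_left (norm_nonneg v) hen)
      nlinarith [norm_nonneg v])
    rw [← hee, inner_sub_right]
    linarith
  have hev1 : ∀ᶠ n in atTop, x (τ n) ∈ Metric.ball p (r / 2) :=
    hτp.eventually (Metric.ball_mem_nhds p (by linarith))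
  have hev2 : ∀ᶠ n in atTop, F (x (τ n)) < F p + c * (r / 2) :=
    hlim.eventually (eventually_lt_nhds (by nlinarith))
  obtain ⟨n, hn1, hn2⟩ := (hev1.and hev2).exists
  set a := τ n
  have ha : 0 ≤ a := hτ0 n
  have hstay : ∀ b, a ≤ b → x b ∈ Metric.ball p r := by
    by_contra! hcon
    obtain ⟨b, hab, hb⟩ := hcon
    -- At the first exit time `σ` the curve has moved more than `r / 2`, but the descent available
    -- pays for less than `r / 2`.
    set A : Set ℝ := Icc a b ∩ x ⁻¹' (Metric.ball p r)ᶜ with hA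
    have hAclosed : IsClosed A :=
      (hcont a b ha hab).preimage_isClosed_of_isClosed isClosed_Icc Metric.isOpen_ball.isClosed_compl
    have hAne : A.Nonempty := ⟨b, ⟨hab, le_rfl⟩, hb⟩
    have hAbdd : BddBelow A := ⟨a, fun t ht => ht.1.1⟩
    have hmem := hAclosed.csInf_mem hAne hAbdd
    set σ := sInf A
    have h1 := hlength a σ ha hmem.1.1 (by
      intro t ht
      by_contra hnt
      have : t ∈ A := ⟨⟨ht.1, ht.2.le.trans hmem.1.2⟩, hnt⟩
      exact absurd (csInf_le hAbdd this) (not_le.2 ht.2))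
    have h2 := hlow σ (ha.trans hmem.1.1)
    have h3 : r ≤ ‖x σ - p‖ := by
      have := hmem.2
      simpa [Metric.mem_ball, dist_eq_norm] using this
    have h4 : ‖x a - p‖ < r / 2 := by simpa [Metric.mem_ball, dist_eq_norm] using hn1
    have h5 : ‖x σ - p‖ ≤ ‖x σ - x a‖ + ‖x a - p‖ := norm_sub_le_norm_sub_add_norm_sub _ _ _
    have h6 : r / 2 < ‖x σ - x a‖ := by linarith
    nlinarith
  have hdecay : ∀ b, a ≤ b → F (x b) + c ^ 2 * b ≤ F (x a) + c ^ 2 * a := by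
    intro b hab
    have hid : AbsolutelyContinuousOnInterval (fun t : ℝ => t) a b :=
      (LipschitzWith.id.lipschitzOnWith (s := uIcc a b)).absolutelyContinuousOnInterval
    refine ((hacF a b ha hab).fun_add (hid.const_mul (c ^ 2))).le_of_deriv_nonpos hab ?_
    filter_upwards [hderiv a b ha hab] with t ht htm
    obtain ⟨v, hv, h, hcv⟩ := ht htm
    have hce := hcv (hstay t htm.1)
    have hd : HasDerivAt (fun t => F (x t) + c ^ 2 * t) (-‖v‖ ^ 2 + c ^ 2 * 1) t :=
      h.add ((hasDerivAt_id t).const_mul _)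
    rw [hd.deriv]
    nlinarith
  have hc2 : 0 < c ^ 2 := by positivity
  -- After this time the descent is at least `c²` more than `F (x a) - F p`.
  have hlast := hdecay (a + ((F (x a) - F p) / c ^ 2 + 1)) (by
    have := div_nonneg (sub_nonneg.2 (hlow a ha)) hc2.le
    linarith)
  have hlow' := hlow (a + ((F (x a) - F p) / c ^ 2 + 1)) (by
    have := div_nonneg (sub_nonneg.2 (hlow a ha)) hc2.le
    linarith)
  have : c ^ 2 * ((F (x a) - F p) / c ^ 2) = F (x a) - F p := by field_simp
  nlinarith

end Descent

end WeaklyConvexFlow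

/-! ### Convex combinations of tails and limits of selections -/

/-- Banach–Saks type lemma: in a Hilbert space, suitable convex combinations of the tails of a
bounded sequence converge in norm. -/
theorem exists_tendsto_convexHull_tail {H : Type*} [NormedAddCommGroup H] [InnerProductSpace ℝ H]
    [CompleteSpace H] {u : ℕ → H} {R : ℝ} (hu : ∀ n, ‖u n‖ ≤ R) :
    ∃ (h : ℕ → H) (g : H), (∀ n, h n ∈ convexHull ℝ (u '' Ici n)) ∧ Tendsto h atTop (𝓝 g) := by
  set C : ℕ → Set H := fun n => closure (convexHull ℝ (u '' Ici n)) with hC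
  have hCconv : ∀ n, Convex ℝ (C n) := fun n => (convex_convexHull ℝ _).closure
  have hCanti : ∀ n k, n ≤ k → C k ⊆ C n := fun n k hnk =>
    closure_mono (convexHull_mono (image_mono (Ici_subset_Ici.2 hnk)))
  have huC : ∀ n, u n ∈ C n := fun n => subset_closure (subset_convexHull ℝ _ ⟨n, self_mem_Ici, rfl⟩)
  -- `q` is the projection of `0` on `C n`. As the `C n` shrink, the norms of these projections
  -- increase and stay below `R`; the variational inequality turns this into the Cauchy property.
  have hmin : ∀ n, ∃ q ∈ C n, ∀ w ∈ C n, ‖q‖ ^ 2 ≤ inner ℝ q w := by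
    intro n
    obtain ⟨q, hq, hqe⟩ := exists_norm_eq_iInf_of_complete_convex ⟨_, huC n⟩
      isClosed_closure.isComplete (hCconv n) 0
    refine ⟨q, hq, fun w hw => ?_⟩
    have := (norm_eq_iInf_iff_real_inner_le_zero (hCconv n) hq).1 hqe w hw
    rw [zero_sub, inner_neg_left, inner_sub_right, real_inner_self_eq_norm_sq] at this
    linarith
  choose q hqC hq using hmin
  have hdist : ∀ n k, n ≤ k → ‖q k - q n‖ ^ 2 ≤ ‖q k‖ ^ 2 - ‖q n‖ ^ 2 := by
    intro n k hnk
    have := hq n (q k) (hCanti n k hnk (hqC k))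
    rw [norm_sub_sq_real, real_inner_comm]
    linarith
  have hmono : Monotone fun n => ‖q n‖ ^ 2 := fun n k hnk => by
    have := hdist n k hnk
    have := sq_nonneg ‖q k - q n‖
    dsimp only
    linarith
  have hbdd : BddAbove (range fun n => ‖q n‖ ^ 2) := by
    refine ⟨R ^ 2, ?_⟩
    rintro _ ⟨n, rfl⟩
    have h1 := (hq n (u n) (huC n)).trans (real_inner_le_norm _ _)
    have h2 : ‖q n‖ ≤ ‖u n‖ := by
      by_contra! hlt
      nlinarith [norm_nonneg (u n)]
    exact pow_le_pow_left₀ (norm_nonneg _) (h2.trans (hu n)) 2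
  have hcs : CauchySeq fun n => ‖q n‖ ^ 2 := (tendsto_atTop_ciSup hmono hbdd).cauchySeq
  have hcq : CauchySeq q := by
    rw [Metric.cauchySeq_iff'] at hcs ⊢
    intro ε hε
    obtain ⟨N, hN⟩ := hcs (ε ^ 2) (by positivity)
    refine ⟨N, fun n hn => ?_⟩
    have h1 := (abs_lt.1 (hN n hn)).2
    have h2 := hdist N n hn
    rw [dist_eq_norm]
    exact lt_of_pow_lt_pow_left₀ 2 hε.le (by linarith)
  obtain ⟨g, hg⟩ := cauchySeq_tendsto_of_complete hcq
  have happ : ∀ n : ℕ, ∃ h ∈ convexHull ℝ (u '' Ici n), dist (q n) h < 1 / ((n : ℝ) + 1) :=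
    fun n => Metric.mem_closure_iff.1 (hqC n) _ (by positivity)
  choose h hh hdh using happ
  refine ⟨h, g, hh, ?_⟩
  refine hg.congr_dist ?_
  exact squeeze_zero (fun _ => dist_nonneg) (fun n => (hdh n).le)
    tendsto_one_div_add_atTop_nhds_zero_nat

/-- If the integrals of `g k` converge and the `g k` are dominated by a square-integrable
function, then the limit is the integral of a function with values in the closed convex hulls of
all tails of `g`. -/
theorem MeasureTheory.exists_integral_eq_of_tendsto_integral {S V : Type*} [MeasurableSpace S]
    {P : Measure S} [IsFiniteMeasure P] [NormedAddCommGroup V] [InnerProductSpace ℝ V]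
    [CompleteSpace V] {g : ℕ → S → V} {M : S → ℝ}
    (hM : MemLp M 2 P) (hg : ∀ k, AEStronglyMeasurable (g k) P)
    (hgM : ∀ k, ∀ᵐ s ∂P, ‖g k s‖ ≤ M s) {v : V}
    (hv : Tendsto (fun k => ∫ s, g k s ∂P) atTop (𝓝 v)) :
    ∃ G : S → V, Integrable G P ∧ ∫ s, G s ∂P = v ∧
      ∀ᵐ s ∂P, ∀ n, G s ∈ closure (convexHull ℝ ((fun k => g k s) '' Ici n)) := by
  have hmem : ∀ k, MemLp (g k) 2 P := fun k => hM.mono' (hg k) (hgM k)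
  set u : ℕ → Lp V 2 P := fun k => (hmem k).toLp (g k) with hu
  have hbound : ∀ k, ‖u k‖ ≤ ‖hM.toLp M‖ := fun k => by
    refine Lp.norm_le_norm_of_ae_le ?_
    filter_upwards [(hmem k).coeFn_toLp, hM.coeFn_toLp, hgM k] with s h1 h2 h3
    rw [h1, h2]
    exact h3.trans (le_abs_self _)
  obtain ⟨h, G, hh, hlim⟩ := exists_tendsto_convexHull_tail hbound
  have hint : ∀ w : Lp V 2 P, Integrable w P := fun w => (Lp.memLp w).integrable one_le_two
  have hhull : ∀ n, ∀ᵐ s ∂P, h n s ∈ convexHull ℝ ((fun k => g k s) '' Ici n) := by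
    intro n
    have hsub : convexHull ℝ (u '' Ici n) ⊆
        {w : Lp V 2 P | ∀ᵐ s ∂P, w s ∈ convexHull ℝ ((fun k => g k s) '' Ici n)} := by
      refine convexHull_min ?_ ?_
      · rintro _ ⟨k, hk, rfl⟩
        filter_upwards [(hmem k).coeFn_toLp] with s hs
        rw [hs]
        exact subset_convexHull ℝ _ ⟨k, hk, rfl⟩
      · intro w hw w' hw' α β hα hβ hαβ
        filter_upwards [hw, hw', Lp.coeFn_add (α • w) (β • w'), Lp.coeFn_smul α w,
          Lp.coeFn_smul β w'] with s h1 h2 h3 h4 h5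
        rw [h3, Pi.add_apply, h4, h5]
        exact convex_convexHull ℝ _ h1 h2 hα hβ hαβ
    exact hsub (hh n)
  have hinth : ∀ n, ∫ s, h n s ∂P ∈ convexHull ℝ ((fun k => ∫ s, g k s ∂P) '' Ici n) := by
    intro n
    have hsub : convexHull ℝ (u '' Ici n) ⊆
        {w : Lp V 2 P | ∫ s, w s ∂P ∈ convexHull ℝ ((fun k => ∫ s, g k s ∂P) '' Ici n)} := by
      refine convexHull_min ?_ ?_
      · rintro _ ⟨k, hk, rfl⟩
        refine subset_convexHull ℝ _ ⟨k, hk, ?_⟩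
        exact (integral_congr_ae (hmem k).coeFn_toLp).symm
      · intro w hw w' hw' α β hα hβ hαβ
        have : ∫ s, (α • w + β • w' : Lp V 2 P) s ∂P = α • ∫ s, w s ∂P + β • ∫ s, w' s ∂P := by
          rw [← integral_smul, ← integral_smul,
            ← integral_add (by exact (hint w).smul α) (by exact (hint w').smul β)]
          refine integral_congr_ae ?_
          filter_upwards [Lp.coeFn_add (α • w) (β • w'), Lp.coeFn_smul α w,
            Lp.coeFn_smul β w'] with s h3 h4 h5
          rw [h3, Pi.add_apply, h4, h5]
          rfl
        rw [mem_ofPred_eq, this]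
        exact convex_convexHull ℝ _ hw hw' hα hβ hαβ
    exact hsub (hh n)
  have hinttend : Tendsto (fun n => ∫ s, h n s ∂P) atTop (𝓝 v) := by
    rw [Metric.tendsto_atTop] at hv ⊢
    intro ε hε
    obtain ⟨N, hN⟩ := hv ε hε
    refine ⟨N, fun n hn => ?_⟩
    have hsub : convexHull ℝ ((fun k => ∫ s, g k s ∂P) '' Ici n) ⊆ Metric.ball v ε := by
      refine convexHull_min ?_ (convex_ball v ε)
      rintro _ ⟨k, hk, rfl⟩
      exact hN k (le_trans hn hk)
    exact hsub (hinth n)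
  -- `L²` convergence gives convergence in measure, hence almost everywhere along a subsequence,
  -- which pointwise hull membership requires.
  obtain ⟨ns, hns, hae⟩ := (tendstoInMeasure_of_tendsto_Lp hlim).exists_seq_tendsto_ae
  have hdom : ∀ n, ∀ᵐ s ∂P, ‖h n s‖ ≤ M s := by
    intro n
    filter_upwards [hhull n, ae_all_iff.2 hgM] with s h1 h2
    have hsub : convexHull ℝ ((fun k => g k s) '' Ici n) ⊆ Metric.closedBall 0 (M s) := by
      refine convexHull_min ?_ (convex_closedBall _ _)
      rintro _ ⟨k, -, rfl⟩
      simpa using h2 k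
    simpa using hsub h1
  refine ⟨G, hint G, ?_, ?_⟩
  · refine tendsto_nhds_unique ?_ (hinttend.comp hns.tendsto_atTop)
    exact tendsto_integral_of_dominated_convergence M (fun n => Lp.aestronglyMeasurable _)
      (hM.integrable one_le_two) (fun n => hdom _) hae
  · filter_upwards [hae, ae_all_iff.2 hhull] with s h1 h2 n
    refine mem_closure_of_tendsto h1 ?_
    filter_upwards [hns.tendsto_atTop.eventually_ge_atTop n] with i hi
    exact convexHull_mono (image_mono (Ici_subset_Ici.2 hi)) (h2 (ns i))

/-! ### Fréchet subgradients of weakly convex functions -/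

namespace WeaklyConvexFlow

variable {d : ℕ}

/-- A Fréchet subgradient of a convex function satisfies the subgradient inequality. -/
theorem le_of_mem_frechetSubdiff_of_convexOn {c : E d → ℝ} {D : Set (E d)} (hc : ConvexOn ℝ D c)
    {y z g : E d} (hz : z ∈ D) (hy : y ∈ D) (hg : g ∈ frechetSubdiff c z) :
    c z + inner ℝ g (y - z) ≤ c y := by
  have key : ∀ ε : ℝ, 0 < ε → c z + inner ℝ g (y - z) - ε * ‖y - z‖ ≤ c y := by
    intro ε hε
    -- Apply the local inequality at a point of the segment close to `z`, bound by convexity, and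
    -- divide by `τ`.
    have hcont : Tendsto (fun τ : ℝ => z + τ • (y - z)) (𝓝[>] 0) (𝓝 z) := by
      have : Continuous fun τ : ℝ => z + τ • (y - z) := by fun_prop
      exact (this.tendsto' 0 z (by simp)).mono_left nhdsWithin_le_nhds
    have hlt : ∀ᶠ τ : ℝ in 𝓝[>] 0, τ < 1 :=
      nhdsWithin_le_nhds (eventually_lt_nhds one_pos)
    obtain ⟨τ, h1, h2, h3⟩ := ((hcont.eventually (hg ε hε)).and
      (hlt.and self_mem_nhdsWithin)).exists
    replace h3 : 0 < τ := h3
    have hconv := hc.2 hz hy (sub_nonneg.2 h2.le) h3.le (sub_add_cancel 1 τ)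
    have heq : (1 - τ) • z + τ • y = z + τ • (y - z) := by module
    rw [heq, smul_eq_mul, smul_eq_mul] at hconv
    rw [add_sub_cancel_left, real_inner_smul_right, norm_smul, Real.norm_of_nonneg h3.le] at h1
    refine le_of_mul_le_mul_left ?_ h3
    linarith
  refine le_of_forall_pos_le_add fun η hη => ?_
  have h := key (η / (‖y - z‖ + 1)) (by positivity)
  have : η / (‖y - z‖ + 1) * ‖y - z‖ ≤ η := by
    rw [div_mul_eq_mul_div, div_le_iff₀ (by positivity)]
    nlinarith
  linarith

/-- A convex quadratic lies above its tangent at `z`. Thus a subgradient `g` of `h` at `z` yields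
the subgradient `g + l • (z - x)` of the convexified function. -/
theorem half_norm_sub_sq_ge (x y z : E d) {l : ℝ} (hl : 0 ≤ l) :
    l / 2 * ‖z - x‖ ^ 2 + l * inner ℝ (z - x) (y - z) ≤ l / 2 * ‖y - x‖ ^ 2 := by
  have h : y - x = (y - z) + (z - x) := by abel
  rw [h, norm_add_sq_real, real_inner_comm (z - x) (y - z)]
  have := mul_nonneg hl (sq_nonneg ‖y - z‖)
  linarith

/-- The subgradient inequality for Fréchet subgradients of a weakly convex function. -/
theorem weaklyConvex_subgradient_inequality {h : E d → ℝ} {x : E d} {ε l : ℝ} (hl : 0 ≤ l)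
    (hc : ConvexOn ℝ (Metric.closedBall x ε) fun y => h y + l / 2 * ‖y - x‖ ^ 2)
    {y z g : E d} (hz : z ∈ Metric.closedBall x ε) (hy : y ∈ Metric.closedBall x ε)
    (hg : g ∈ frechetSubdiff h z) :
    h z + l / 2 * ‖z - x‖ ^ 2 + inner ℝ g (y - z) + l * inner ℝ (z - x) (y - z) ≤
      h y + l / 2 * ‖y - x‖ ^ 2 := by
  have hmem : g + l • (z - x) ∈ frechetSubdiff (fun y => h y + l / 2 * ‖y - x‖ ^ 2) z := by
    intro η hη
    filter_upwards [hg η hη] with w hw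
    have := half_norm_sub_sq_ge x w z hl
    rw [inner_add_left, real_inner_smul_left]
    linarith
  have := le_of_mem_frechetSubdiff_of_convexOn hc hz hy hmem
  rw [inner_add_left, real_inner_smul_left] at this
  linarith

/-- A function with a quadratic minorant at `x` has the corresponding Fréchet subgradient. -/
theorem mem_frechetSubdiff_of_quadratic_minorant {h : E d → ℝ} {x g : E d} {ε l : ℝ}
    (hε : 0 < ε)
    (hy : ∀ y ∈ Metric.closedBall x ε, h x + inner ℝ g (y - x) ≤ h y + l / 2 * ‖y - x‖ ^ 2) :
    g ∈ frechetSubdiff h x := by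
  intro η hη
  have h1 : Tendsto (fun y : E d => l / 2 * ‖y - x‖) (𝓝 x) (𝓝 0) := by
    have : Continuous fun y : E d => l / 2 * ‖y - x‖ := by fun_prop
    exact this.tendsto' x 0 (by simp)
  filter_upwards [h1.eventually (eventually_lt_nhds hη), Metric.closedBall_mem_nhds x hε]
    with y h2 h3
  have := hy y h3
  have := mul_le_mul_of_nonneg_right h2.le (norm_nonneg (y - x))
  nlinarith

/-- Fréchet subgradients are bounded by a local Lipschitz constant. -/
theorem norm_le_of_mem_frechetSubdiff {h : E d → ℝ} {z g : E d} {M : ℝ} (hM : 0 ≤ M)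
    (hlip : ∀ᶠ y in 𝓝 z, |h y - h z| ≤ M * ‖y - z‖) (hg : g ∈ frechetSubdiff h z) : ‖g‖ ≤ M := by
  refine le_of_forall_pos_le_add fun η hη => ?_
  rcases eq_or_ne g 0 with rfl | hg0
  · rw [norm_zero]
    positivity
  -- In the direction of `g` itself the growth is at least `(‖g‖ - η) * ‖τ • g‖`.
  have hcont : Tendsto (fun τ : ℝ => z + τ • g) (𝓝[>] 0) (𝓝 z) := by
    have : Continuous fun τ : ℝ => z + τ • g := by fun_prop
    exact (this.tendsto' 0 z (by simp)).mono_left nhdsWithin_le_nhds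
  obtain ⟨τ, h1, h2, h3⟩ := ((hcont.eventually (hg η hη)).and
    ((hcont.eventually hlip).and self_mem_nhdsWithin)).exists
  replace h3 : 0 < τ := h3
  rw [add_sub_cancel_left, norm_smul, Real.norm_of_nonneg h3.le] at h1 h2
  rw [real_inner_smul_right, real_inner_self_eq_norm_sq] at h1
  have h4 := (abs_le.1 h2).2
  have hpos : 0 < τ * ‖g‖ := mul_pos h3 (norm_pos_iff.2 hg0)
  refine le_of_mul_le_mul_right ?_ hpos
  nlinarith

theorem convexSubdiff_subset_frechetSubdiff (φ : E d → ℝ) (x : E d) :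
    convexSubdiff φ x ⊆ frechetSubdiff φ x := fun v hv ε hε =>
  Eventually.of_forall fun y => by
    have := hv y
    have := mul_nonneg hε.le (norm_nonneg (y - x))
    linarith

/-- The sum of subgradients and of a normal vector is a subgradient of the restricted sum. -/
theorem add_mem_subdiffWithin {h φ : E d → ℝ} {X : Set (E d)} {x v w n : E d}
    (hv : v ∈ frechetSubdiff h x) (hw : w ∈ convexSubdiff φ x) (hn : n ∈ normalCone X x) :
    v + w + n ∈ subdiffWithin (fun y => h y + φ y) X x := by
  intro ε hε
  filter_upwards [nhdsWithin_le_nhds (hv ε hε), self_mem_nhdsWithin] with y h1 hy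
  have h2 := hw y
  have h3 := hn.2 y hy
  rw [inner_add_left, inner_add_left]
  linarith

/-! ### Random integrands, their integrated subdifferentials and the closed graph -/

section Random

variable {S : Type*} [MeasurableSpace S] {P : Measure S}

/-- Data for the integrand near a point: Lipschitz constants, weak convexity moduli, and
integrability on a common ball. -/
theorem exists_local_data [IsFiniteMeasure P] {X : Set (E d)} {f : E d → S → ℝ}
    (hfmeas : ∀ y, AEStronglyMeasurable (f y) P) (hfint : ∀ y ∈ X, Integrable (f y) P)
    (hLip : LocallyLipschitzOn P f X) (hweak : LocallyWeaklyConvexOn P f X) {x : E d}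
    (hx : x ∈ X) :
    ∃ ε : ℝ, 0 < ε ∧ ∃ M lam : S → ℝ, MemLp M 2 P ∧ (∀ s, 0 ≤ M s) ∧ Integrable lam P ∧
      (∀ s, 0 ≤ lam s) ∧
      (∀ᵐ s ∂P, ∀ y ∈ Metric.closedBall x ε, ∀ z ∈ Metric.closedBall x ε,
        |f y s - f z s| ≤ M s * ‖y - z‖) ∧
      (∀ᵐ s ∂P, ConvexOn ℝ (Metric.closedBall x ε) fun y => f y s + lam s / 2 * ‖y - x‖ ^ 2) ∧
      ∀ y ∈ Metric.closedBall x ε, Integrable (f y) P := by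
  obtain ⟨ε₁, hε₁, M, hM, h1⟩ := hLip x hx
  obtain ⟨ε₂, hε₂, lam, hlam, hlam0, h2⟩ := hweak x hx
  have hs1 : Metric.closedBall x (min ε₁ ε₂) ⊆ Metric.closedBall x ε₁ :=
    Metric.closedBall_subset_closedBall (min_le_left _ _)
  have hs2 : Metric.closedBall x (min ε₁ ε₂) ⊆ Metric.closedBall x ε₂ :=
    Metric.closedBall_subset_closedBall (min_le_right _ _)
  have h1' : ∀ᵐ s ∂P, ∀ y ∈ Metric.closedBall x (min ε₁ ε₂),
      ∀ z ∈ Metric.closedBall x (min ε₁ ε₂), |f y s - f z s| ≤ ‖M s‖ * ‖y - z‖ := by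
    filter_upwards [h1] with s hs y hy z hz
    exact (hs y (hs1 hy) z (hs1 hz)).trans
      (mul_le_mul_of_nonneg_right (le_abs_self _) (norm_nonneg _))
  refine ⟨min ε₁ ε₂, lt_min hε₁ hε₂, fun s => ‖M s‖, lam, hM.norm, fun s => norm_nonneg _, hlam,
    hlam0, h1', ?_, ?_⟩
  · filter_upwards [h2] with s hs
    exact hs.subset hs2 (convex_closedBall _ _)
  · intro y hy
    -- Integrability is assumed only on `X`; off `X` it follows from the Lipschitz comparison with
    -- the centre `x`.
    have hdiff : Integrable (fun s => f y s - f x s) P := by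
      refine Integrable.mono' ((hM.norm.integrable one_le_two).mul_const ‖y - x‖)
        ((hfmeas y).sub (hfmeas x)) ?_
      filter_upwards [h1'] with s hs
      exact hs y hy x (Metric.mem_closedBall_self (le_min hε₁.le hε₂.le))
    have := hdiff.add (hfint x hx)
    refine this.congr (Eventually.of_forall fun s => ?_)
    simp

/-- The expected function is locally Lipschitz. -/
theorem locallyLipschitzOn_expected [IsFiniteMeasure P] {X : Set (E d)} {f : E d → S → ℝ}
    (hfmeas : ∀ y, AEStronglyMeasurable (f y) P) (hfint : ∀ y ∈ X, Integrable (f y) P)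
    (hLip : LocallyLipschitzOn P f X) (hweak : LocallyWeaklyConvexOn P f X) :
    _root_.LocallyLipschitzOn X (expected P f) := by
  intro x hx
  obtain ⟨ε, hε, M, lam, hM, hM0, -, -, h1, -, hint⟩ :=
    exists_local_data hfmeas hfint hLip hweak hx
  refine ⟨(∫ s, M s ∂P).toNNReal, Metric.closedBall x ε,
    nhdsWithin_le_nhds (Metric.closedBall_mem_nhds x hε), ?_⟩
  refine LipschitzOnWith.of_dist_le_mul fun y hy z hz => ?_
  rw [Real.coe_toNNReal _ (integral_nonneg hM0), Real.dist_eq, dist_eq_norm, expected, expected,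
    ← integral_sub (hint y hy) (hint z hz), ← integral_mul_const]
  refine (abs_integral_le_integral_abs).trans
    (integral_mono_ae ((hint y hy).sub (hint z hz)).abs
      ((hM.integrable one_le_two).mul_const _) ?_)
  filter_upwards [h1] with s hs using hs y hy z hz

/-- Integrating subgradients of the integrands gives subgradients of the expected function. -/
theorem setIntegral_subset_frechetSubdiff_expected [IsFiniteMeasure P] {X : Set (E d)}
    {f : E d → S → ℝ}
    (hfmeas : ∀ y, AEStronglyMeasurable (f y) P) (hfint : ∀ y ∈ X, Integrable (f y) P)
    (hLip : LocallyLipschitzOn P f X) (hweak : LocallyWeaklyConvexOn P f X) {x : E d}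
    (hx : x ∈ X) :
    setIntegral P (fun s => frechetSubdiff (fun y => f y s) x) ⊆
      frechetSubdiff (expected P f) x := by
  rintro _ ⟨g, hg, hgs, rfl⟩
  obtain ⟨ε, hε, M, lam, -, -, hlam, hlam0, -, h2, hint⟩ :=
    exists_local_data hfmeas hfint hLip hweak hx
  -- The remainders in the Fréchet inequalities need not be uniform in `s`. Weak convexity replaces
  -- them by `lam s / 2 * ‖y - x‖ ^ 2`, which can be integrated.
  refine mem_frechetSubdiff_of_quadratic_minorant (l := ∫ s, lam s ∂P) hε fun y hy => ?_
  have hxm : x ∈ Metric.closedBall x ε := Metric.mem_closedBall_self hε.le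
  have hinner : Integrable (fun s => inner ℝ (y - x) (g s)) P := hg.const_inner (y - x)
  have hlam2 : Integrable (fun s => lam s / 2 * ‖y - x‖ ^ 2) P := (hlam.div_const 2).mul_const _
  rw [real_inner_comm, ← integral_inner hg, expected, expected, ← integral_add (hint x hxm) hinner,
    ← integral_div, ← integral_mul_const, ← integral_add (hint y hy) hlam2]
  refine integral_mono_ae ((hint x hxm).add hinner) ((hint y hy).add hlam2) ?_
  filter_upwards [hgs, h2] with s h3 h4
  have := weaklyConvex_subgradient_inequality (hlam0 s) h4 hxm hy h3
  rw [real_inner_comm] at this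
  simpa using this

/-- Subgradients of a weakly convex function at points converging to `x` accumulate, after
closed convexification, at subgradients at `x`. -/
theorem mem_frechetSubdiff_of_mem_closure_convexHull {h : E d → ℝ} {x : E d} {ε l M : ℝ}
    (hε : 0 < ε) (hl : 0 ≤ l)
    (hc : ConvexOn ℝ (Metric.closedBall x ε) fun y => h y + l / 2 * ‖y - x‖ ^ 2)
    (hlip : ∀ y ∈ Metric.closedBall x ε, |h y - h x| ≤ M * ‖y - x‖)
    {z : ℕ → E d} (hz : ∀ k, z k ∈ Metric.closedBall x ε) (hzx : Tendsto z atTop (𝓝 x))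
    {g : ℕ → E d} (hgM : ∀ k, ‖g k‖ ≤ M) (hg : ∀ k, g k ∈ frechetSubdiff h (z k)) {G : E d}
    (hG : ∀ n, G ∈ closure (convexHull ℝ (g '' Ici n))) : G ∈ frechetSubdiff h x := by
  refine mem_frechetSubdiff_of_quadratic_minorant (l := l) hε fun y hy => ?_
  have hnorm : Tendsto (fun k => ‖z k - x‖) atTop (𝓝 0) :=
    tendsto_iff_norm_sub_tendsto_zero.1 hzx
  -- This is the error of moving the subgradient inequality from `z k` to `x`: one `M` from `h (z
  -- k)` against `h x`, one from `⟪g k, z k - x⟫`, and the rest from the slope of the quadratic.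
  have hB : Tendsto (fun k => (2 * M + l * ‖y - z k‖) * ‖z k - x‖) atTop (𝓝 0) := by
    have h1 : Tendsto (fun k => 2 * M + l * ‖y - z k‖) atTop (𝓝 (2 * M + l * ‖y - x‖)) :=
      (((tendsto_const_nhds.sub hzx).norm).const_mul l).const_add _
    simpa using h1.mul hnorm
  refine le_of_forall_pos_le_add fun η hη => ?_
  obtain ⟨N, hN⟩ := eventually_atTop.1 (hB.eventually (eventually_lt_nhds hη))
  -- A closed half-space that contains a tail of `g` contains its closed convex hull, hence `G`.
  set A : Set (E d) := {u | inner ℝ u (y - x) ≤ h y + l / 2 * ‖y - x‖ ^ 2 + η - h x} with hA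
  have hAclosed : IsClosed A := isClosed_le (by fun_prop) continuous_const
  have hAconv : Convex ℝ A := by
    intro u hu u' hu' a b ha hb hab
    simp only [hA, mem_ofPred_eq] at hu hu' ⊢
    rw [inner_add_left, real_inner_smul_left, real_inner_smul_left]
    calc _ ≤ a * (h y + l / 2 * ‖y - x‖ ^ 2 + η - h x) +
          b * (h y + l / 2 * ‖y - x‖ ^ 2 + η - h x) := by gcongr
      _ = _ := by rw [← add_mul, hab, one_mul]
  have hsub : g '' Ici N ⊆ A := by
    rintro _ ⟨k, hk, rfl⟩
    have h1 := weaklyConvex_subgradient_inequality hl hc (hz k) hy (hg k)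
    have h2 := (abs_le.1 (hlip (z k) (hz k))).1
    have h3 := hN k hk
    have h4 : inner ℝ (g k) (y - x) = inner ℝ (g k) (y - z k) + inner ℝ (g k) (z k - x) := by
      rw [← inner_add_right, sub_add_sub_cancel]
    have h5 : inner ℝ (g k) (z k - x) ≤ M * ‖z k - x‖ :=
      (real_inner_le_norm _ _).trans (mul_le_mul_of_nonneg_right (hgM k) (norm_nonneg _))
    have h6 : -(‖z k - x‖ * ‖y - z k‖) ≤ inner ℝ (z k - x) (y - z k) :=
      (abs_le.1 (abs_real_inner_le_norm _ _)).1
    have h7 := mul_le_mul_of_nonneg_left h6 hl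
    have h8 : 0 ≤ l / 2 * ‖z k - x‖ ^ 2 := by positivity
    simp only [hA, mem_ofPred_eq]
    linarith
  have := closure_minimal (convexHull_min hsub hAconv) hAclosed (hG N)
  simp only [hA, mem_ofPred_eq] at this
  linarith

/-- The set-valued integral of the subdifferentials is locally bounded. -/
theorem exists_norm_le_of_mem_setIntegral [IsFiniteMeasure P] {f : E d → S → ℝ} {x : E d} {ε : ℝ}
    {M : S → ℝ} (hM : MemLp M 2 P) (hM0 : ∀ s, 0 ≤ M s)
    (hlip : ∀ᵐ s ∂P, ∀ y ∈ Metric.closedBall x ε, ∀ z ∈ Metric.closedBall x ε,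
      |f y s - f z s| ≤ M s * ‖y - z‖) {z : E d} (hz : z ∈ Metric.ball x ε) {g : S → E d}
    (hg : ∀ᵐ s ∂P, g s ∈ frechetSubdiff (fun y => f y s) z) :
    (∀ᵐ s ∂P, ‖g s‖ ≤ M s) ∧ ‖∫ s, g s ∂P‖ ≤ ∫ s, M s ∂P := by
  have h1 : ∀ᵐ s ∂P, ‖g s‖ ≤ M s := by
    filter_upwards [hg, hlip] with s hs hl
    refine norm_le_of_mem_frechetSubdiff (hM0 s) ?_ hs
    filter_upwards [Metric.isOpen_ball.mem_nhds hz] with y hy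
    exact hl y (Metric.ball_subset_closedBall hy) z (Metric.ball_subset_closedBall hz)
  exact ⟨h1, norm_integral_le_of_norm_le (hM.integrable one_le_two) h1⟩

/-- The map `G + N_X` has closed graph over `X`. -/
theorem mem_subgradientMap_add_normalCone_of_tendsto [IsFiniteMeasure P] {X : Set (E d)}
    {f : E d → S → ℝ} {φ : E d → ℝ} (hφ : ConvexOn ℝ univ φ)
    (hfmeas : ∀ y, AEStronglyMeasurable (f y) P) (hfint : ∀ y ∈ X, Integrable (f y) P)
    (hLip : LocallyLipschitzOn P f X) (hweak : LocallyWeaklyConvexOn P f X)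
    {z u : ℕ → E d} {x a : E d} (hx : x ∈ X) (hz : Tendsto z atTop (𝓝 x))
    (hu : ∀ k, u k ∈ subgradientMap P f φ (z k) + normalCone X (z k))
    (hua : Tendsto u atTop (𝓝 a)) : a ∈ subgradientMap P f φ x + normalCone X x := by
  obtain ⟨ε, hε, M, lam, hM, hM0, -, hlam0, h1, h2, -⟩ :=
    exists_local_data hfmeas hfint hLip hweak hx
  obtain ⟨K, t, ht, hK⟩ := hφ.locallyLipschitz x
  obtain ⟨δ, hδ, hδt⟩ := Metric.mem_nhds_iff.1 ht
  wlog hball : ∀ k, z k ∈ Metric.ball x (min ε δ) generalizing z u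
  · obtain ⟨N, hN⟩ := eventually_atTop.1
      (hz.eventually (Metric.ball_mem_nhds x (lt_min hε hδ)))
    exact this (hz.comp (tendsto_add_atTop_nat N)) (fun k => hu (k + N))
      (hua.comp (tendsto_add_atTop_nat N)) fun k => hN _ (Nat.le_add_left _ _)
  have hzε : ∀ k, z k ∈ Metric.ball x ε := fun k =>
    Metric.ball_subset_ball (min_le_left _ _) (hball k)
  have hzδ : ∀ k, z k ∈ Metric.ball x δ := fun k =>
    Metric.ball_subset_ball (min_le_right _ _) (hball k)
  have hdecomp : ∀ k, ∃ (g : S → E d) (w n : E d), Integrable g P ∧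
      (∀ᵐ s ∂P, g s ∈ frechetSubdiff (fun y => f y s) (z k)) ∧ w ∈ convexSubdiff φ (z k) ∧
      n ∈ normalCone X (z k) ∧ ∫ s, g s ∂P + w + n = u k := by
    intro k
    obtain ⟨_, ⟨_, ⟨g, hg, hgs, rfl⟩, w, hw, rfl⟩, n, hn, h⟩ := hu k
    exact ⟨g, w, n, hg, hgs, hw, hn, h⟩
  choose g w n hg hgs hw hn hsum using hdecomp
  have hgM := fun k => exists_norm_le_of_mem_setIntegral hM hM0 h1 (hzε k) (hgs k)
  have hwK : ∀ k, ‖w k‖ ≤ K := fun k => by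
    refine norm_le_of_mem_frechetSubdiff K.2 ?_ (convexSubdiff_subset_frechetSubdiff φ _ (hw k))
    filter_upwards [Metric.isOpen_ball.mem_nhds (hzδ k)] with y hy
    have := hK.dist_le_mul y (hδt hy) (z k) (hδt (hzδ k))
    rwa [Real.dist_eq, dist_eq_norm] at this
  -- Only the parts from `f` and `φ` are bounded a priori; the normal vectors then converge because
  -- the sums `u` do.
  have hcomp : IsCompact (Metric.closedBall (0 : E d) (∫ s, M s ∂P) ×ˢ
      Metric.closedBall (0 : E d) K) :=
    (isCompact_closedBall _ _).prod (isCompact_closedBall _ _)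
  obtain ⟨⟨v', w'⟩, -, ψ, hψ, hlim⟩ := hcomp.tendsto_subseq
    (x := fun k => (∫ s, g k s ∂P, w k))
    (fun k => ⟨by simpa using (hgM k).2, by simpa using hwK k⟩)
  have hv' : Tendsto (fun k => ∫ s, g (ψ k) s ∂P) atTop (𝓝 v') :=
    (continuous_fst.tendsto _).comp hlim
  have hw' : Tendsto (fun k => w (ψ k)) atTop (𝓝 w') := (continuous_snd.tendsto _).comp hlim
  have hzψ : Tendsto (fun k => z (ψ k)) atTop (𝓝 x) := hz.comp hψ.tendsto_atTop
  have hnlim : Tendsto (fun k => n (ψ k)) atTop (𝓝 (a - v' - w')) := by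
    refine (((hua.comp hψ.tendsto_atTop).sub hv').sub hw').congr fun k => ?_
    rw [Function.comp_apply, ← hsum (ψ k)]
    abel
  have hw'mem : w' ∈ convexSubdiff φ x := by
    intro y
    have hcont : Tendsto (fun k => φ (z (ψ k))) atTop (𝓝 (φ x)) :=
      (hφ.locallyLipschitz.continuous.tendsto x).comp hzψ
    exact le_of_tendsto (hcont.add (hw'.inner (tendsto_const_nhds.sub hzψ)))
      (Eventually.of_forall fun k => hw (ψ k) y)
  have hn'mem : a - v' - w' ∈ normalCone X x := by
    refine ⟨hx, fun y hy => ?_⟩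
    exact le_of_tendsto (hnlim.inner (tendsto_const_nhds.sub hzψ))
      (Eventually.of_forall fun k => (hn (ψ k)).2 y hy)
  obtain ⟨G, hGint, hGv, hG⟩ := exists_integral_eq_of_tendsto_integral hM
    (fun k => (hg (ψ k)).aestronglyMeasurable) (fun k => (hgM (ψ k)).1) hv'
  have hGmem : ∀ᵐ s ∂P, G s ∈ frechetSubdiff (fun y => f y s) x := by
    filter_upwards [hG, h1, h2, ae_all_iff.2 hgs, ae_all_iff.2 fun k => (hgM k).1]
      with s a1 a2 a3 a4 a5
    exact mem_frechetSubdiff_of_mem_closure_convexHull hε (hlam0 s) a3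
      (fun y hy => a2 y hy x (Metric.mem_closedBall_self hε.le))
      (fun k => Metric.ball_subset_closedBall (hzε (ψ k))) hzψ (fun k => a5 (ψ k))
      (fun k => a4 (ψ k)) a1
  refine ⟨v' + w', ⟨v', ⟨G, hGint, hGmem, hGv.symm⟩, w', hw'mem, rfl⟩, a - v' - w', hn'mem, ?_⟩
  change v' + w' + (a - v' - w') = a
  abel

end Random

end WeaklyConvexFlow

/-! ### Stationarity of cluster points -/

theorem mainTheorem4 {d : ℕ} {S : Type*} [MeasurableSpace S]
    (P : Measure S) [IsProbabilityMeasure P]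
    (X : Set (WeaklyConvexFlow.E d)) (hXclosed : IsClosed X) (hXconvex : Convex ℝ X)
    (f : WeaklyConvexFlow.E d → S → ℝ) (φ : WeaklyConvexFlow.E d → ℝ)
    (hφ : ConvexOn ℝ univ φ)
    (hfmeas : ∀ y, AEStronglyMeasurable (f y) P)
    (hfint : ∀ y ∈ X, Integrable (f y) P)
    (hLip : WeaklyConvexFlow.LocallyLipschitzOn P f X)
    (hweak : WeaklyConvexFlow.LocallyWeaklyConvexOn P f X)
    (x : ℝ → WeaklyConvexFlow.E d)
    (hx : WeaklyConvexFlow.IsTrajectory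
      (fun y => -WeaklyConvexFlow.subgradientMap P f φ y - WeaklyConvexFlow.normalCone X y) x)
    (xinf : WeaklyConvexFlow.E d) (hxinf : WeaklyConvexFlow.IsTrajectoryClusterPt x xinf) :
    WeaklyConvexFlow.IsMinimalSubgradient P f φ X xinf 0 ∧
      (0 : WeaklyConvexFlow.E d) ∈
        WeaklyConvexFlow.subgradientMap P f φ xinf + WeaklyConvexFlow.normalCone X xinf := by
  have hx2 := (ae_restrict_iff' measurableSet_Ici).1 hx.2
  have hcont : ContinuousOn x (Ici 0) := by
    intro t ht
    have h := (hx.1 (t + 1) (by linarith [mem_Ici.1 ht])).continuousOn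
    rw [uIcc_of_le (by linarith [mem_Ici.1 ht])] at h
    refine (h t ⟨ht, by linarith⟩).mono_of_mem_nhdsWithin ?_
    rw [← Ici_inter_Iic]
    exact inter_mem self_mem_nhdsWithin (nhdsWithin_le_nhds (Iic_mem_nhds (by linarith)))
  -- The normal cone is empty off `X`, so `x t ∈ X` for almost every `t`; such times are dense, `x`
  -- is continuous and `X` is closed.
  have hxX : ∀ t, 0 ≤ t → x t ∈ X := by
    have hae : ∀ᵐ t : ℝ, t ∈ Ioi (0 : ℝ) → x t ∈ X := by
      filter_upwards [hx2] with t ht h0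
      obtain ⟨v, -, _, -, n, hn, -⟩ := ht (Ioi_subset_Ici_self h0)
      exact hn.1
    intro t ht
    have hsub : Ici (0 : ℝ) ⊆ closure ({t | t ∈ Ioi (0 : ℝ) → x t ∈ X} ∩ Ioi 0) := by
      rw [inter_comm, ← closure_Ioi]
      exact closure_minimal ((Measure.dense_of_ae hae).open_subset_closure_inter isOpen_Ioi)
        isClosed_closure
    have hmaps : MapsTo x ({t | t ∈ Ioi (0 : ℝ) → x t ∈ X} ∩ Ioi 0) X := fun s hs => hs.1 hs.2
    have hcl := (hcont t ht).mono (s := {t | t ∈ Ioi (0 : ℝ) → x t ∈ X} ∩ Ioi 0)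
      (fun s hs => Ioi_subset_Ici_self hs.2)
    exact hXclosed.closure_subset (hcl.mem_closure (hsub ht) hmaps)
  obtain ⟨τ, hτ0, -, hτ, hτp⟩ := hxinf
  have hpX : xinf ∈ X := hXclosed.mem_of_tendsto hτp (Eventually.of_forall fun n => hxX _ (hτ0 n))
  have hF : _root_.LocallyLipschitzOn X fun y => WeaklyConvexFlow.expected P f y + φ y := by
    intro y hy
    obtain ⟨K₁, t₁, ht₁, hK₁⟩ :=
      WeaklyConvexFlow.locallyLipschitzOn_expected hfmeas hfint hLip hweak hy
    obtain ⟨K₂, t₂, ht₂, hK₂⟩ := hφ.locallyLipschitz y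
    exact ⟨K₁ + K₂, t₁ ∩ t₂, inter_mem ht₁ (nhdsWithin_le_nhds ht₂),
      (hK₁.mono inter_subset_left).add (hK₂.mono inter_subset_right)⟩
  have hstat : (0 : WeaklyConvexFlow.E d) ∈
      WeaklyConvexFlow.subgradientMap P f φ xinf + WeaklyConvexFlow.normalCone X xinf := by
    -- A single `c` serves as radius and as lower bound, so the negation with `c = 1 / (k + 1)`
    -- gives both `y k → xinf` and `u k → 0`.
    by_cases hbound : ∃ c : ℝ, 0 < c ∧ ∀ y ∈ Metric.ball xinf c,
        ∀ u ∈ WeaklyConvexFlow.subgradientMap P f φ y + WeaklyConvexFlow.normalCone X y, c ≤ ‖u‖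
    · obtain ⟨c, hc, hcu⟩ := hbound
      refine (WeaklyConvexFlow.not_clusterPt_of_speed_bound hF hx.1 hxX hpX hc hc ?_ hτ0 hτ
        hτp).elim
      filter_upwards [hx2] with t ht h0
      obtain ⟨v, hv, g, hg, n, hn, rfl⟩ := ht h0
      obtain ⟨a, ha, b, hb, hab⟩ := id hg
      have heq : -(g - n) = a + b + n := by
        have : g = -(a + b) := by rw [← neg_neg g]; exact congrArg Neg.neg hab.symm
        rw [this]
        abel
      refine ⟨g - n, hv, ?_, fun hb' => ?_⟩
      · rw [heq]
        exact WeaklyConvexFlow.add_mem_subdiffWithin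
          (WeaklyConvexFlow.setIntegral_subset_frechetSubdiff_expected hfmeas hfint hLip hweak
            (hxX t h0) ha) hb hn
      · rw [← norm_neg]
        refine hcu _ hb' _ ?_
        rw [heq]
        exact add_mem_add (add_mem_add ha hb) hn
    · push Not at hbound
      choose y hy u hu huc using fun k : ℕ => hbound (1 / ((k : ℝ) + 1)) (by positivity)
      have hy' : Tendsto y atTop (𝓝 xinf) := by
        rw [tendsto_iff_dist_tendsto_zero]
        exact squeeze_zero (fun _ => dist_nonneg) (fun k => (Metric.mem_ball.1 (hy k)).le)
          tendsto_one_div_add_atTop_nhds_zero_nat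
      have hu' : Tendsto u atTop (𝓝 0) :=
        squeeze_zero_norm (fun k => (huc k).le) tendsto_one_div_add_atTop_nhds_zero_nat
      exact WeaklyConvexFlow.mem_subgradientMap_add_normalCone_of_tendsto hφ hfmeas hfint hLip
        hweak hpX hy' hu hu'
  refine ⟨⟨?_, fun h _ => by rw [norm_zero]; exact norm_nonneg h⟩, hstat⟩
  exact add_subset_add_right (add_subset_add_right
    (WeaklyConvexFlow.setIntegral_subset_frechetSubdiff_expected hfmeas hfint hLip hweak hpX))
    hstat
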